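/- Let $K$ be an oriented knot diagram on the sphere whose arcs are colored by a quandle $X$ (each arc carries an element of $X$, subject to the quandle relation at each crossing; equivalently, this is a homomorphism to $X$ from the fundamental quandle of the knot). Suppose that the coloring is non-trivial, i.e. uses more than one color, and that two distinct arcs $a \neq b$ have the same color $x \in X$. Then a finite sequence of Reidemeister moves of type II, with the coloring carried along (colors away from each move are unchanged), leads to an equivalent, again non-trivially colored diagram $K'$ with two distinct arcs $a' \ne b'$, both of color $x$, such that cutting $a'$ and $b'$ at one suitable point each yields a diagram of a 2-tangle in a disc (the two cut points being on the boundary of a common face of $K'$) whose two components have non-zero linking number. Here the linking number of a 2-tangle diagram is half the sum of the signs of the crossings between its two components, which are oriented by the orientation of the knot. -/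

import Mathlib

open Quandles

namespace KnotTangle

/-! ### Crossings

A crossing of an oriented diagram is passed through twice, once along its over-strand and once along
its under-strand. For a set `C` of crossings the *passages* are the elements of `C × Bool`:
`(c, true)` is the over-passage of `c` and `(c, false)` its under-passage. -/

/-- The other passage through the same crossing. -/
def other {C : Type} (y : C × Bool) : C × Bool := (y.1, !y.2)

/-- At passage `y`, the other strand of the crossing goes from the right of the strand of `y` to
its left. (At a positive crossing the under-strand crosses the over-strand from right to left, hence
the over-strand crosses the under-strand from left to right; a negative crossing is the mirror
image.) -/
abbrev CrossedLeftward {C : Type} (sign : C → ℤˣ) (y : C × Bool) : Prop :=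
  sign y.1 = if y.2 then 1 else -1

/-! ### Oriented knot diagrams on the sphere -/

/-- A signed Gauss code: crossings with their signs, and for each passage the following passage in
the direction of the orientation. The *edges* (segments of the curve between consecutive passages)
are indexed by passages too: the edge `x` runs from passage `x` to passage `next x`. -/
structure GaussCode where
  Crossing : Type
  [fintypeCrossing : Fintype Crossing]
  [decEqCrossing : DecidableEq Crossing]
  sign : Crossing → ℤˣ
  next : Equiv.Perm (Crossing × Bool)

attribute [instance] GaussCode.fintypeCrossing GaussCode.decEqCrossing

namespace GaussCode

variable (D : GaussCode)

/-- Edges, indexed by the passage at which they start. -/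
abbrev Edge : Type := D.Crossing × Bool

/-- Walk along the boundary of a face, keeping the face on the left. The state `(x, true)` means
walking along edge `x` in its direction, `(x, false)` means walking along edge `x` against its
direction. At the end of the edge one turns left at the crossing. -/
def faceStep : D.Edge × Bool → D.Edge × Bool
  | (x, true) =>
      let y := D.next x
      if CrossedLeftward D.sign y then (other y, true) else (D.next.symm (other y), false)
  | (x, false) =>
      if CrossedLeftward D.sign x then (D.next.symm (other x), false) else (other x, true)

/-- The faces: the orbits of the boundary walk. -/
def Face : Type := Quot fun s t : D.Edge × Bool => t = D.faceStep s

/-- The arcs: an edge and the next one belong to the same arc if the passage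
between them is an over-passage. -/
def Arc : Type := Quot fun x y : D.Edge => y = D.next x ∧ y.2 = true

/-- The arc that contains a given edge. -/
def arcOf (x : D.Edge) : D.Arc := Quot.mk _ x

end GaussCode

/-- An oriented knot diagram on the sphere, up to isotopy of the sphere, with at least one crossing
(the circle without crossings has only one arc): a signed Gauss code that consists of one closed
curve and that satisfies Euler's formula `V + F = E + 2` of a cellular decomposition of the
sphere. -/
structure KnotDiagram extends GaussCode where
  one_component : ∀ x y, next.SameCycle x y
  planar : Fintype.card Crossing + Nat.card toGaussCode.Face
    = Fintype.card (Crossing × Bool) + 2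

/-! ### Colorings by quandles -/

/-- A knot diagram with a coloring by a quandle `X` : each arc has a color, and at each crossing
the color of the under-arc on the left of the over-arc is the result of the action of the color of
the over-arc on the color of the under-arc on its right. (Equivalently, a quandle homomorphism to `X`
from the fundamental quandle, which is presented by these generators and relations.) -/
structure ColoredDiagram (X : Type*) [Quandle X] where
  diagram : KnotDiagram
  color : diagram.Arc → X
  pos : ∀ c, diagram.sign c = 1 →
    color (diagram.arcOf (c, false)) =
      color (diagram.arcOf (c, true)) ◃ color (diagram.arcOf (diagram.next.symm (c, false)))
  neg : ∀ c, diagram.sign c = -1 →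
    color (diagram.arcOf (diagram.next.symm (c, false))) =
      color (diagram.arcOf (c, true)) ◃ color (diagram.arcOf (c, false))

/-- More than one color is used. -/
def ColoredDiagram.IsNontrivial {X : Type*} [Quandle X] (K : ColoredDiagram X) : Prop :=
  ∃ a b, K.color a ≠ K.color b

/-! ### Reidemeister moves of type II -/

/-- `D'` arises from `D` by a Reidemeister II move that creates two crossings `c₁`, `c₂`:
they have opposite signs, one strand passes over both of them consecutively and the other strand
passes under both of them consecutively (in the same or in the opposite order), so that the two
strands bound a bigon; deleting `c₁` and `c₂` from `D'` leaves `D`. -/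
structure R2Creation (D D' : KnotDiagram) where
  c₁ : D'.Crossing
  c₂ : D'.Crossing
  sign_ne : D'.sign c₁ ≠ D'.sign c₂
  over_consecutive : D'.next (c₁, true) = (c₂, true)
  under_consecutive : D'.next (c₁, false) = (c₂, false) ∨ D'.next (c₂, false) = (c₁, false)
  /-- the inclusion of the old crossings -/
  incl : D.Crossing → D'.Crossing
  incl_injective : Function.Injective incl
  range_incl : ∀ c, c ∈ Set.range incl ↔ c ≠ c₁ ∧ c ≠ c₂
  sign_incl : ∀ c, D'.sign (incl c) = D.sign c
  /-- between consecutive old passages there are only new passages -/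
  next_incl : ∀ x : D.Crossing × Bool, ∃ k : ℕ,
    D'.next^[k + 1] (incl x.1, x.2) = (incl (D.next x).1, (D.next x).2) ∧
    ∀ j < k, (D'.next^[j + 1] (incl x.1, x.2)).1 = c₁ ∨
      (D'.next^[j + 1] (incl x.1, x.2)).1 = c₂

/-- A colored Reidemeister II move that creates two crossings: the colors of the old edges, at their
starting points, do not change. (The remaining colors are determined by these.) -/
def ColoredR2Creation {X : Type*} [Quandle X] (K K' : ColoredDiagram X) : Prop :=
  ∃ m : R2Creation K.diagram K'.diagram, ∀ x : K.diagram.Edge,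
    K'.color (K'.diagram.arcOf (m.incl x.1, x.2)) = K.color (K.diagram.arcOf x)

/-- A colored Reidemeister II move, in either direction. -/
def ColoredR2Move {X : Type*} [Quandle X] (K K' : ColoredDiagram X) : Prop :=
  ColoredR2Creation K K' ∨ ColoredR2Creation K' K

/-! ### Diagrams of 2-tangles -/

/-- The combinatorial data of an oriented tangle diagram in a disc whose strands are indexed by
`Bool`. The edges are indexed by the points where they start: `inl y` is a passage and `inr i` is
the initial endpoint of strand `i`. The edge `x` ends at `next x`, where `inl y` is a passage and
`inr i` now stands for the terminal endpoint of strand `i`. The endpoints on the boundary circle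
of the disc are the pairs `(i, true)` (initial) and `(i, false)` (terminal), and `boundaryNext`
sends an endpoint to the next one in counterclockwise order. -/
structure TangleCode where
  Crossing : Type
  [fintypeCrossing : Fintype Crossing]
  [decEqCrossing : DecidableEq Crossing]
  sign : Crossing → ℤˣ
  next : Equiv.Perm ((Crossing × Bool) ⊕ Bool)
  boundaryNext : Equiv.Perm (Bool × Bool)

attribute [instance] TangleCode.fintypeCrossing TangleCode.decEqCrossing

namespace TangleCode

variable (T : TangleCode)

abbrev Edge : Type := (T.Crossing × Bool) ⊕ Bool

/-- Enter the disc at an endpoint: along the initial edge of a strand in its direction, or along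
the terminal edge of a strand against its direction. -/
def enter : Bool × Bool → T.Edge × Bool
  | (i, true) => (.inr i, true)
  | (i, false) => (T.next.symm (.inr i), false)

/-- Walk along the boundary of a region, keeping the region on the left, as for knot diagrams;
from an endpoint one proceeds along the boundary circle to the next endpoint and enters the disc
again there. -/
def faceStep : T.Edge × Bool → T.Edge × Bool
  | (x, true) =>
      match T.next x with
      | .inl y =>
          if CrossedLeftward T.sign y then (.inl (other y), true)
          else (T.next.symm (.inl (other y)), false)
      | .inr i => T.enter (T.boundaryNext (i, false))
  | (.inl y, false) =>
      if CrossedLeftward T.sign y then (T.next.symm (.inl (other y)), false)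
      else (.inl (other y), true)
  | (.inr i, false) => T.enter (T.boundaryNext (i, true))

/-- The regions into which the diagram divides the disc. -/
def Face : Type := Quot fun s t : T.Edge × Bool => t = T.faceStep s

end TangleCode

/-- A diagram of a 2-tangle: two oriented strands in a disc, strand `i` running from its initial to
its terminal endpoint, and no closed components. In the permutation `next` the two ends of each
strand are identified, so it has two cycles, one for each strand. Planarity is expressed by Euler's
formula `V + F = E + 2` for the sphere that arises from the disc by collapsing the boundary circle
to a vertex of degree four. -/
structure TwoTangleDiagram extends TangleCode where
  two_strands : ¬ next.SameCycle (.inr false) (.inr true)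
  no_closed_component : ∀ x, ∃ i, next.SameCycle (.inr i) x
  boundary_cyclic : ∀ a b, boundaryNext.SameCycle a b
  planar : (Fintype.card Crossing + 1) + Nat.card toTangleCode.Face
    = Fintype.card ((Crossing × Bool) ⊕ Bool) + 2

open Classical in
/-- The linking number of the two components of a 2-tangle: half the sum of the signs of the
crossings at which the two passages belong to different strands. -/
noncomputable def TwoTangleDiagram.linkingNumber (T : TwoTangleDiagram) : ℚ :=
  (∑ c : T.Crossing, if T.next.SameCycle (.inl (c, true)) (.inl (c, false)) then 0
    else ((T.sign c : ℤ) : ℚ)) / 2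

/-- `T` arises from the knot diagram `D` by cutting the edges `e` and `f` at one point each, `T`
being drawn in the complement of a small disc that meets the curve of `D` only in a neighborhood of
the two points. Strand `false` runs from the cut of `e` to the cut of `f`, and strand `true` from the
cut of `f` to the cut of `e`. The two ends at each cut are neighbors on the boundary circle. -/
structure IsCut (D : KnotDiagram) (e f : D.Edge) (T : TwoTangleDiagram) where
  equiv : D.Crossing ≃ T.Crossing
  sign_equiv : ∀ c, T.sign (equiv c) = D.sign c
  start_false : T.next (.inr false) = .inl (equiv (D.next e).1, (D.next e).2)
  end_false : T.next (.inl (equiv f.1, f.2)) = .inr false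
  start_true : T.next (.inr true) = .inl (equiv (D.next f).1, (D.next f).2)
  end_true : T.next (.inl (equiv e.1, e.2)) = .inr true
  next_equiv : ∀ x, x ≠ e → x ≠ f →
    T.next (.inl (equiv x.1, x.2)) = .inl (equiv (D.next x).1, (D.next x).2)
  /-- the ends at the cut of `e` are the terminal end of strand `true` and the initial end of
  strand `false` -/
  adjacent_e : T.boundaryNext (true, false) = (false, true) ∨
    T.boundaryNext (false, true) = (true, false)
  /-- the ends at the cut of `f` are the terminal end of strand `false` and the initial end of
  strand `true` -/
  adjacent_f : T.boundaryNext (false, false) = (true, true) ∨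
    T.boundaryNext (true, true) = (false, false)

end KnotTangle

/-!
If an edge `p` is pushed over an edge `q`, the two outer pieces of `q` keep their color, and both of
them lie on the boundary of the face into which `p` has been pushed. The last one can therefore be
pushed over the first one, and its middle piece then shares a face with the last piece of the first
one. These two edges have the color of `q`, and they belong to different arcs, since the second of
them begins and ends at an under-passage. When the knot is cut there, one of the two strands is the
part of `q` that passes under `p`, up to the new middle piece. It crosses under `p` at two crossings
of opposite signs, which contribute nothing to the linking number even if `p` belongs to the other
strand, and then over the other strand at exactly one crossing. So the linking number is `1 / 2` or
`-1 / 2`.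
-/

namespace KnotTangle

open Equiv.Perm

section Permutations

variable {α β : Type*}

theorem sameCycle_of_apply_eq {f : Equiv.Perm α} {x y : α} (h : f x = y) : f.SameCycle x y :=
  h ▸ sameCycle_apply_right.2 (.refl f x)

theorem rel_of_sameCycle [Finite α] {f : Equiv.Perm α} (r : Setoid α) (h : ∀ x, r x (f x))
    {x y : α} (hxy : f.SameCycle x y) : r x y := by
  obtain ⟨n, rfl⟩ := hxy.exists_nat_pow_eq
  induction n with
  | zero => exact r.refl x
  | succ n ih =>
    rw [pow_succ', mul_apply]
    exact r.trans (ih ⟨n, rfl⟩) (h _)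

theorem sameCycle_map [Finite α] {f : Equiv.Perm α} {g : Equiv.Perm β} (φ : α → β)
    (h : ∀ x, g.SameCycle (φ x) (φ (f x))) {x y : α} (hxy : f.SameCycle x y) :
    g.SameCycle (φ x) (φ y) :=
  rel_of_sameCycle ((SameCycle.setoid g).comap φ) h hxy

theorem rel_of_sameCycle_mul_swap [Finite α] [DecidableEq α] {f : Equiv.Perm α} {a b : α}
    (r : Setoid α) (h : ∀ x, r x (f x)) (hab : r a b) {x y : α}
    (hxy : (f * Equiv.swap a b).SameCycle x y) : r x y := by
  refine rel_of_sameCycle r (fun x => r.trans ?_ (h (Equiv.swap a b x))) hxy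
  rw [Equiv.swap_apply_def]
  split_ifs with ha hb
  · rwa [ha]
  · rw [hb]; exact r.symm hab
  · exact r.refl x

theorem sameCycle_of_sameCycle_mul_swap [Finite α] [DecidableEq α] {f : Equiv.Perm α} {a b : α}
    (hab : f.SameCycle a b) {x y : α} (hxy : (f * Equiv.swap a b).SameCycle x y) :
    f.SameCycle x y :=
  rel_of_sameCycle_mul_swap (SameCycle.setoid f) (fun _ => sameCycle_of_apply_eq rfl) hab hxy

/-- A union `S` of cycles of `f * swap a b` that contains `b` but not `a`. If `f` is a single cycle,
then `S` is its segment that starts after `a` and ends with `b`. -/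
structure IsSegment [DecidableEq α] (f : Equiv.Perm α) (a b : α) (S : Finset α) : Prop where
  end_mem : b ∈ S
  start_notMem : a ∉ S
  apply_mem_iff : ∀ x, f (Equiv.swap a b x) ∈ S ↔ x ∈ S

theorem isSegment_image_range [DecidableEq α] {f : Equiv.Perm α} {a b : α} (hab : a ≠ b) {k : ℕ}
    (hk : (f ^ k) a = b) (hmin : ∀ j < k, (f ^ j) a ≠ b) :
    IsSegment f a b ((Finset.range k).image fun j => (f ^ (j + 1)) a) := by
  have no_return (j : ℕ) (hj : j < k) : (f ^ (j + 1)) a ≠ a := by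
    intro h
    refine hmin (k - (j + 1)) (by omega) ?_
    rw [← hk]
    conv_rhs => rw [← Nat.sub_add_cancel hj, pow_add, mul_apply, h]
  have hk0 : k ≠ 0 := by rintro rfl; exact hab hk
  set S := (Finset.range k).image fun j => (f ^ (j + 1)) a with hS
  have maps (x : α) (hx : x ∈ S) : (f * Equiv.swap a b) x ∈ S := by
    obtain ⟨j, hj, rfl⟩ := Finset.mem_image.1 hx
    rw [Finset.mem_range] at hj
    refine Finset.mem_image.2 ?_
    obtain hlast | hlt := (Nat.succ_le_of_lt hj).eq_or_lt
    · exact ⟨0, by simpa using hk0.bot_lt, by simp [show j + 1 = k from hlast, hk]⟩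
    · refine ⟨j + 1, by simpa using hlt, ?_⟩
      rw [mul_apply, Equiv.swap_apply_of_ne_of_ne (no_return j hj) (hmin _ hlt), ← mul_apply,
        ← pow_succ']
  refine ⟨?_, by simpa [hS] using no_return, fun x => ?_⟩
  · exact Finset.mem_image.2 ⟨k - 1, by simpa using hk0.bot_lt, by rwa [Nat.sub_one_add_one hk0]⟩
  · refine ⟨fun hx => ?_, maps x⟩
    rw [← (f * Equiv.swap a b).symm_apply_apply x]
    exact perm_symm_on_of_perm_on_finset maps hx

theorem isSegment_pair [DecidableEq α] {f : Equiv.Perm α} {a : α} (h₁ : f a ≠ a)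
    (h₂ : f (f a) ≠ a) : IsSegment f a (f (f a)) {f a, f (f a)} where
  end_mem := by simp
  start_notMem := by simp [h₁.symm, h₂.symm]
  apply_mem_iff x := by
    have h₃ : f a ≠ f (f a) := f.injective.ne h₁.symm
    simp [Equiv.swap_apply_eq_iff, Equiv.swap_apply_of_ne_of_ne h₁ h₃, or_comm]

theorem exists_isSegment [Finite α] [DecidableEq α] {f : Equiv.Perm α} {a b : α} (hab : a ≠ b)
    (h : f.SameCycle a b) : ∃ S, IsSegment f a b S := by
  have hex : ∃ k : ℕ, (f ^ k) a = b := h.exists_nat_pow_eq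
  exact ⟨_, isSegment_image_range hab (Nat.find_spec hex) fun j hj => Nat.find_min hex hj⟩

theorem IsSegment.not_sameCycle [Finite α] [DecidableEq α] {f : Equiv.Perm α} {a b : α}
    {S : Finset α} (hS : IsSegment f a b S) : ¬ (f * Equiv.swap a b).SameCycle a b := fun h =>
  hS.start_notMem <| (rel_of_sameCycle (Setoid.ker (· ∈ S))
    (fun x => propext (hS.apply_mem_iff x).symm) h).mpr hS.end_mem

end Permutations

/-! ### Orbits of maps -/

/-- The orbits of a map, two elements being in the same orbit if they are related by the equivalence
relation that identifies each `x` with `f x`. -/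
def Orbits {α : Type*} (f : α → α) : Type _ := Quot fun s t : α => t = f s

namespace Orbits

variable {α β : Type*}

/-- The orbit of an element. -/
def mk (f : α → α) (x : α) : Orbits f := Quot.mk _ x

@[simp] theorem mk_apply (f : α → α) (x : α) : mk f (f x) = mk f x :=
  (Quot.sound (r := fun s t : α => t = f s) rfl).symm

theorem mk_eq_of_sameCycle [Finite α] {f : Equiv.Perm α} {x y : α} (h : f.SameCycle x y) :
    mk f x = mk f y :=
  rel_of_sameCycle (Setoid.ker (mk f)) (fun x => (mk_apply f x).symm) h

theorem card_congr {f : α → α} {g : β → β} (φ : α → β) (ψ : β → α)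
    (hφ : ∀ x, mk g (φ (f x)) = mk g (φ x)) (hψ : ∀ y, mk f (ψ (g y)) = mk f (ψ y))
    (hψφ : ∀ x, mk f (ψ (φ x)) = mk f x) (hφψ : ∀ y, mk g (φ (ψ y)) = mk g y) :
    Nat.card (Orbits f) = Nat.card (Orbits g) :=
  Nat.card_congr
    { toFun := Quot.lift (fun x => mk g (φ x)) (by rintro x _ rfl; exact (hφ x).symm)
      invFun := Quot.lift (fun y => mk f (ψ y)) (by rintro y _ rfl; exact (hψ y).symm)
      left_inv := by rintro ⟨x⟩; exact hψφ x
      right_inv := by rintro ⟨y⟩; exact hφψ y }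

theorem card_optionCongr [Finite α] (f : Equiv.Perm α) :
    Nat.card (Orbits f.optionCongr) = Nat.card (Orbits f) + 1 := by
  have : Finite (Orbits f) := Quot.finite _
  rw [← Finite.card_option]
  refine Nat.card_congr
    { toFun := Quot.lift (Option.map (mk f)) ?_
      invFun := fun o => o.elim (mk _ none)
        (Quot.lift (fun x => mk f.optionCongr (some x)) ?_)
      left_inv := ?_
      right_inv := ?_ }
  · rintro (_ | x) _ rfl <;> simp
  · rintro x _ rfl
    exact (mk_apply f.optionCongr (some x)).symm
  · rintro ⟨_ | x⟩ <;> rfl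
  · rintro (_ | q)
    · rfl
    · induction q using Quot.ind with | mk x => rfl

theorem mk_some_eq_of_sameCycle [Finite α] {f : Equiv.Perm α} {x y : α} (h : f.SameCycle x y) :
    mk f.optionCongr (some x) = mk f.optionCongr (some y) :=
  rel_of_sameCycle (Setoid.ker fun x => mk f.optionCongr (some x))
    (fun x => (mk_apply f.optionCongr (some x)).symm) h

theorem card_mul_swap [Finite α] [DecidableEq α] (f : Equiv.Perm α) {a b : α} (hab : a ≠ b)
    (h : f.SameCycle a b) :
    Nat.card (Orbits (f * Equiv.swap a b)) = Nat.card (Orbits f) + 1 := by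
  classical
  obtain ⟨S, hS⟩ := exists_isSegment hab h
  set g := f * Equiv.swap a b with hg
  have hba : ¬ g.SameCycle b a := fun h => hS.not_sameCycle h.symm
  have hbb : g.SameCycle b b := .refl g b
  have hga : g a = f b := by simp [hg]
  have hgb : g b = f a := by simp [hg]
  have hgx (x : α) (h1 : x ≠ a) (h2 : x ≠ b) : g x = f x := by
    simp [hg, Equiv.swap_apply_of_ne_of_ne h1 h2]
  rw [← card_optionCongr f]
  -- The cycle of `b` under `g` is the new orbit; the rest of the old cycle is represented by `a`.
  refine (card_congr (f := f.optionCongr)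
    (fun o => o.elim b fun x => if g.SameCycle b x then a else x)
    (fun y => if g.SameCycle b y then none else some y) ?_ ?_ ?_ ?_).symm
  · rintro (_ | x)
    · rfl
    by_cases h1 : x = a
    · simp [h1, ← hgb, hba, hbb]
    by_cases h2 : x = b
    · simp [h2, ← hga, hba, hbb]
    simp only [Equiv.optionCongr_apply, Option.map_some, Option.elim_some, ← hgx x h1 h2,
      sameCycle_apply_right]
    split_ifs <;> simp
  · intro y
    simp only [sameCycle_apply_right]
    split_ifs
    · rfl
    · exact mk_some_eq_of_sameCycle
        (sameCycle_of_sameCycle_mul_swap h (sameCycle_apply_left.2 (.refl g y)))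
  · rintro (_ | x)
    · simp [hbb]
    by_cases hx : g.SameCycle b x
    · simpa [hx, hba] using
        mk_some_eq_of_sameCycle (h.trans (sameCycle_of_sameCycle_mul_swap h hx))
    · simp [hx]
  · intro y
    by_cases hy : g.SameCycle b y
    · simpa [hy] using mk_eq_of_sameCycle hy
    · simp [hy]

/-- Here the map `g` is made of pieces of `f`: it takes some steps from `first x` to `last (σ x)`,
all of whose elements are sent to `x` by `ρ`. -/
theorem card_eq_of_pieces {f : Equiv.Perm α} {g : β → β} {σ : α → α} (hσ : ∀ x, σ (σ x) = x)
    (first last : α → β) (ρ : β → α) (hnext : ∀ x, g (last x) = first (f x))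
    (hfirst : ∀ x, ρ (first x) = x) (hlast : ∀ x, ρ (last x) = σ x)
    (hmid : ∀ y, y ∈ Set.range last ∨ ρ (g y) = ρ y)
    (hrep : ∀ y, mk g (first (ρ y)) = mk g y) :
    Nat.card (Orbits g) = Nat.card (Orbits fun x => f (σ x)) := by
  refine card_congr ρ first (fun y => ?_) (fun x => ?_) hrep (fun x => by rw [hfirst])
  · obtain ⟨x, rfl⟩ | h := hmid y
    · rw [hnext, hfirst, hlast]
      simpa [hσ] using mk_apply (fun x => f (σ x)) (σ x)
    · rw [h]
  · rw [← hnext, mk_apply, ← hrep (last _), hlast, hσ]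

end Orbits

/-! ### The boundary walk -/

section Passages

variable {C : Type}

@[simp] theorem other_other (y : C × Bool) : other (other y) = y := by simp [other]

theorem other_ne (y : C × Bool) : other y ≠ y := by
  intro h
  simpa [other] using congrArg Prod.snd h

theorem crossedLeftward_other (sign : C → ℤˣ) (y : C × Bool) :
    CrossedLeftward sign (other y) ↔ ¬ CrossedLeftward sign y := by
  obtain ⟨c, b⟩ := y
  rcases Int.units_eq_one_or (sign c) with h | h <;> cases b <;>
    simp [CrossedLeftward, other, h]

/-- A left turn at a crossing, where `(y, true)` means arriving at the passage `y` from behind, or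
leaving it forward, and `(y, false)` means arriving at it from ahead, or leaving it backward. -/
def turnLeft (sign : C → ℤˣ) (z : (C × Bool) × Bool) : (C × Bool) × Bool :=
  (other z.1, if CrossedLeftward sign z.1 then z.2 else !z.2)

theorem turnLeft_turnLeft (sign : C → ℤˣ) (z : (C × Bool) × Bool) :
    turnLeft sign (turnLeft sign z) = (z.1, !z.2) := by
  by_cases h : CrossedLeftward sign z.1
  · simp only [turnLeft, if_pos h, if_neg (mt (crossedLeftward_other sign z.1).1 (not_not.2 h)),
      other_other]
  · simp only [turnLeft, if_neg h, if_pos ((crossedLeftward_other sign z.1).2 h), other_other]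

theorem turnLeft_injective (sign : C → ℤˣ) : Function.Injective (turnLeft sign) := by
  intro z w h
  have := congrArg (turnLeft sign) h
  simpa [turnLeft_turnLeft, Prod.ext_iff] using this

end Passages

namespace GaussCode

variable (D : GaussCode)

/-- The passage at which a walk along an edge arrives. -/
def arrive (z : D.Edge × Bool) : D.Edge × Bool := (if z.2 then D.next z.1 else z.1, z.2)

/-- The edge along which one leaves a passage. -/
def depart (z : D.Edge × Bool) : D.Edge × Bool := (if z.2 then z.1 else D.next.symm z.1, z.2)

theorem arrive_injective : Function.Injective D.arrive := by
  rintro ⟨x, _ | _⟩ ⟨y, _ | _⟩ <;> simp [arrive]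

theorem depart_injective : Function.Injective D.depart := by
  rintro ⟨x, _ | _⟩ ⟨y, _ | _⟩ <;> simp [depart]

theorem faceStep_eq (z : D.Edge × Bool) :
    D.faceStep z = D.depart (turnLeft D.sign (D.arrive z)) := by
  obtain ⟨x, _ | _⟩ := z
  · simp only [faceStep, depart, turnLeft, arrive]
    split_ifs <;> simp_all
  · simp only [faceStep, depart, turnLeft, arrive]
    split_ifs <;> simp_all

theorem faceStep_injective : Function.Injective D.faceStep := by
  rw [funext D.faceStep_eq]
  exact D.depart_injective.comp ((turnLeft_injective D.sign).comp D.arrive_injective)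

/-- The boundary walk as a permutation. -/
noncomputable def facePerm : Equiv.Perm (D.Edge × Bool) :=
  .ofBijective D.faceStep (Finite.injective_iff_bijective.1 D.faceStep_injective)

theorem exists_faceStep_ne (e : D.Edge) : ∃ t, (D.faceStep (e, t)).1 ≠ e := by
  by_contra! hall
  by_cases h : CrossedLeftward D.sign (D.next e)
  · have h_next : other (D.next e) = e := by simpa only [faceStep, if_pos h] using hall true
    have h_e : ¬ CrossedLeftward D.sign e := by
      rwa [← h_next, crossedLeftward_other, not_not]
    exact other_ne e (by simpa only [faceStep, if_neg h_e] using hall false)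
  · have h_symm : D.next.symm (other (D.next e)) = e := by
      simpa only [faceStep, if_neg h] using hall true
    exact other_ne _ ((Equiv.symm_apply_eq _).1 h_symm)

end GaussCode

/-! ### Pushing an edge over another one -/

namespace GaussCode

/-- The permutation `next` of the diagram `push` below. Multiplication by `swap x y` inserts the new
passage `y` after the passage `x`. -/
def pushNext (D : GaussCode) (p q : D.Edge) (s t : Bool) :
    Equiv.Perm ((D.Crossing ⊕ Bool) × Bool) :=
  (Equiv.sumProdDistrib D.Crossing Bool Bool).symm.permCongr (D.next.sumCongr (.refl _)) *
    Equiv.swap (.inl p.1, p.2) (.inr false, true) *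
    Equiv.swap (.inr false, true) (.inr true, true) *
    Equiv.swap (.inl q.1, q.2) (.inr (s == t), false) *
    Equiv.swap (.inr (s == t), false) (.inr (!(s == t)), false)

/-- The Reidemeister II move that pushes the edge `p` over the edge `q ≠ p`, across a face that is
on the left of the darts `(p, s)` and `(q, t)`. The new crossings are `inr false` and `inr true`, in
the order in which `p` passes over them; `q` passes first under `inr (s == t)`. -/
def push (D : GaussCode) (p q : D.Edge) (s t : Bool) : GaussCode where
  Crossing := D.Crossing ⊕ Bool
  sign := Sum.elim D.sign fun i => if i = t then -1 else 1
  next := D.pushNext p q s t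

namespace push

variable {D : GaussCode} {p q : D.Edge} {s t : Bool}

/-- A passage of the old diagram as a passage of the new one, or the first piece of an old edge. -/
def old (x : D.Edge) : (D.push p q s t).Edge := (.inl x.1, x.2)

/-- The over-passage (`b = true`) or under-passage (`b = false`) of the new crossing `i`. -/
def new (i b : Bool) : (D.push p q s t).Edge := (.inr i, b)

/-- The last piece of an old edge. -/
def lastPiece (x : D.Edge) : (D.push p q s t).Edge :=
  (D.push p q s t).next.symm (old (D.next x))

/-- The middle piece of the edge `p`. -/
def midOver : (D.push p q s t).Edge := new false true

/-- The middle piece of the edge `q`. -/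
def midUnder : (D.push p q s t).Edge := new (s == t) false

theorem old_injective : Function.Injective (old : D.Edge → (D.push p q s t).Edge) := by
  rintro ⟨c, b⟩ ⟨c', b'⟩ h
  obtain ⟨h1, h2⟩ := Prod.mk.inj h
  exact Prod.ext (Sum.inl_injective h1) h2

theorem next_old_over (hpq : p ≠ q) : (D.push p q s t).next (old p) = midOver := by
  change D.pushNext p q s t (.inl p.1, p.2) = (.inr false, true)
  simp [pushNext, Equiv.swap_apply_def, mt Prod.ext_iff.2 hpq]

theorem next_midOver : (D.push p q s t).next midOver = new true true := by
  change D.pushNext p q s t (.inr false, true) = (.inr true, true)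
  simp [pushNext, Equiv.swap_apply_def]

theorem next_last_over : (D.push p q s t).next (new true true) = old (D.next p) := by
  change D.pushNext p q s t (.inr true, true) = (.inl (D.next p).1, (D.next p).2)
  simp [pushNext, Equiv.swap_apply_def]

theorem next_old_under : (D.push p q s t).next (old q) = midUnder := by
  change D.pushNext p q s t (.inl q.1, q.2) = (.inr (s == t), false)
  simp [pushNext, Equiv.swap_apply_def]

theorem next_midUnder : (D.push p q s t).next midUnder = new (!(s == t)) false := by
  change D.pushNext p q s t (.inr (s == t), false) = (.inr (!(s == t)), false)
  simp [pushNext, Equiv.swap_apply_def]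

theorem next_last_under (hpq : p ≠ q) :
    (D.push p q s t).next (new (!(s == t)) false) = old (D.next q) := by
  change D.pushNext p q s t (.inr (!(s == t)), false) = (.inl (D.next q).1, (D.next q).2)
  simp [pushNext, Equiv.swap_apply_def, mt Prod.ext_iff.2 hpq.symm]

theorem next_old {x : D.Edge} (hp : x ≠ p) (hq : x ≠ q) :
    (D.push p q s t).next (old x) = old (D.next x) := by
  change D.pushNext p q s t (.inl x.1, x.2) = (.inl (D.next x).1, (D.next x).2)
  simp [pushNext, Equiv.swap_apply_def, mt Prod.ext_iff.2 hp, mt Prod.ext_iff.2 hq]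

theorem next_lastPiece (x : D.Edge) :
    (D.push p q s t).next (lastPiece x) = old (D.next x) :=
  (D.push p q s t).next.apply_symm_apply _

theorem lastPiece_over : (lastPiece p : (D.push p q s t).Edge) = new true true :=
  (Equiv.symm_apply_eq _).2 next_last_over.symm

theorem lastPiece_under (hpq : p ≠ q) :
    (lastPiece q : (D.push p q s t).Edge) = new (!(s == t)) false :=
  (Equiv.symm_apply_eq _).2 (next_last_under hpq).symm

theorem lastPiece_of_ne {x : D.Edge} (hp : x ≠ p) (hq : x ≠ q) :
    (lastPiece x : (D.push p q s t).Edge) = old x :=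
  (Equiv.symm_apply_eq _).2 (next_old hp hq).symm

/-- The first piece of a dart of the old diagram. -/
def firstDart (z : D.Edge × Bool) : (D.push p q s t).Edge × Bool :=
  (if z.2 then old z.1 else lastPiece z.1, z.2)

/-- The last piece of a dart of the old diagram. -/
def lastDart (z : D.Edge × Bool) : (D.push p q s t).Edge × Bool :=
  (if z.2 then lastPiece z.1 else old z.1, z.2)

theorem faceStep_lastDart (z : D.Edge × Bool) :
    (D.push p q s t).faceStep (lastDart z) = firstDart (D.faceStep z) := by
  have h_arrive : (D.push p q s t).arrive (lastDart z) = (old (D.arrive z).1, (D.arrive z).2) := by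
    obtain ⟨x, _ | _⟩ := z
    · rfl
    · exact congrArg (·, true) (next_lastPiece x)
  have h_depart (w : D.Edge × Bool) :
      (D.push p q s t).depart (old w.1, w.2) = firstDart (D.depart w) := by
    obtain ⟨x, _ | _⟩ := w
    · simp [depart, firstDart, lastPiece]
    · rfl
  rw [faceStep_eq, faceStep_eq, h_arrive, ← h_depart]
  rfl

theorem turnLeft_new (i b d : Bool) : turnLeft (D.push p q s t).sign (new i b, d) =
    (new i (!b), if b = (i != t) then d else !d) := by
  have h : CrossedLeftward (D.push p q s t).sign (new i b) ↔ b = (i != t) := by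
    cases i <;> cases b <;> cases t <;> simp [CrossedLeftward, push, new]
  exact Prod.ext rfl (if_congr h rfl rfl)

theorem arrive_firstDart_over (hpq : p ≠ q) (d : Bool) :
    (D.push p q s t).arrive (firstDart (p, d)) = (new (!d) true, d) := by
  cases d
  · exact congrArg (·, false) lastPiece_over
  · exact congrArg (·, true) (next_old_over hpq)

theorem arrive_firstDart_under (hpq : p ≠ q) (d : Bool) :
    (D.push p q s t).arrive (firstDart (q, d)) = (new (d == (s == t)) false, d) := by
  cases d
  · refine congrArg (·, false) ((lastPiece_under hpq).trans ?_)
    simp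
  · refine congrArg (·, true) (next_old_under.trans ?_)
    simp [midUnder]

theorem arrive_midOver (d : Bool) :
    (D.push p q s t).arrive (midOver, d) = (new d true, d) := by
  cases d
  · rfl
  · exact congrArg (·, true) next_midOver

theorem arrive_midUnder (d : Bool) :
    (D.push p q s t).arrive (midUnder, d) = (new (d != (s == t)) false, d) := by
  cases d
  · simp [arrive, midUnder]
  · refine congrArg (·, true) (next_midUnder.trans ?_)
    simp

theorem depart_lastDart_over (hpq : p ≠ q) (d : Bool) :
    (D.push p q s t).depart (new d true, d) = lastDart (p, d) := by
  cases d
  · exact congrArg (·, false) ((Equiv.symm_apply_eq _).2 (next_old_over hpq).symm)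
  · exact congrArg (·, true) lastPiece_over.symm

theorem depart_lastDart_under (hpq : p ≠ q) (d : Bool) :
    (D.push p q s t).depart (new (d != (s == t)) false, d) = lastDart (q, d) := by
  cases d
  · simpa [depart, lastDart, midUnder] using (Equiv.symm_apply_eq _).2 next_old_under.symm
  · simp [depart, lastDart, lastPiece_under hpq]

theorem depart_midOver (d : Bool) :
    (D.push p q s t).depart (new (!d) true, d) = (midOver, d) := by
  cases d
  · exact congrArg (·, false) ((Equiv.symm_apply_eq _).2 next_midOver.symm)
  · rfl

theorem depart_midUnder (d : Bool) :
    (D.push p q s t).depart (new (d == (s == t)) false, d) = (midUnder, d) := by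
  cases d
  · simpa [depart] using (Equiv.symm_apply_eq _).2 next_midUnder.symm
  · simp [depart, midUnder]

theorem faceStep_firstDart_over (hpq : p ≠ q) :
    (D.push p q s t).faceStep (firstDart (p, s)) = lastDart (q, t) := by
  rw [faceStep_eq, arrive_firstDart_over hpq, turnLeft_new, ← depart_lastDart_under hpq]
  cases s <;> cases t <;> rfl

theorem faceStep_firstDart_under (hpq : p ≠ q) :
    (D.push p q s t).faceStep (firstDart (q, t)) = lastDart (p, s) := by
  rw [faceStep_eq, arrive_firstDart_under hpq, turnLeft_new, ← depart_lastDart_over hpq]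
  cases s <;> cases t <;> rfl

theorem faceStep_firstDart_over_not (hpq : p ≠ q) :
    (D.push p q s t).faceStep (firstDart (p, !s)) = (midUnder, t) := by
  rw [faceStep_eq, arrive_firstDart_over hpq, turnLeft_new, ← depart_midUnder]
  cases s <;> cases t <;> rfl

theorem faceStep_firstDart_under_not (hpq : p ≠ q) :
    (D.push p q s t).faceStep (firstDart (q, !t)) = (midOver, s) := by
  rw [faceStep_eq, arrive_firstDart_under hpq, turnLeft_new, ← depart_midOver]
  cases s <;> cases t <;> rfl

theorem faceStep_midUnder (hpq : p ≠ q) :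
    (D.push p q s t).faceStep (midUnder, t) = lastDart (p, !s) := by
  rw [faceStep_eq, arrive_midUnder, turnLeft_new, ← depart_lastDart_over hpq]
  cases s <;> cases t <;> rfl

theorem faceStep_midOver (hpq : p ≠ q) :
    (D.push p q s t).faceStep (midOver, s) = lastDart (q, !t) := by
  rw [faceStep_eq, arrive_midOver, turnLeft_new, ← depart_lastDart_under hpq]
  cases s <;> cases t <;> rfl

theorem faceStep_midUnder_not :
    (D.push p q s t).faceStep (midUnder, !t) = (midOver, !s) := by
  rw [faceStep_eq, arrive_midUnder, turnLeft_new, ← depart_midOver]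
  cases s <;> cases t <;> rfl

theorem faceStep_midOver_not :
    (D.push p q s t).faceStep (midOver, !s) = (midUnder, !t) := by
  rw [faceStep_eq, arrive_midOver, turnLeft_new, ← depart_midUnder]
  cases s <;> cases t <;> rfl

theorem passage_cases (y : (D.push p q s t).Edge) :
    (∃ x, y = old x) ∨ y = midOver ∨ y = lastPiece p ∨ y = midUnder ∨
      y = new (!(s == t)) false := by
  rw [lastPiece_over]
  obtain ⟨c | i, b⟩ := y
  · exact .inl ⟨(c, b), rfl⟩
  · right
    cases i <;> cases b <;> cases s <;> cases t <;>
      first | exact .inl rfl | exact .inr (.inl rfl) | exact .inr (.inr (.inl rfl)) |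
        exact .inr (.inr (.inr rfl))

theorem dart_cases (hpq : p ≠ q) (y : (D.push p q s t).Edge × Bool) :
    (∃ z, y = lastDart z) ∨ (∃ d, y = firstDart (p, d)) ∨ (∃ d, y = firstDart (q, d)) ∨
      (∃ d, y = (midOver, d)) ∨ ∃ d, y = (midUnder, d) := by
  obtain ⟨x, d⟩ := y
  have last_cases (r : D.Edge) :
      (∃ z, ((lastPiece r, d) : (D.push p q s t).Edge × Bool) = lastDart z) ∨
      ((lastPiece r, d) : (D.push p q s t).Edge × Bool) = firstDart (r, d) := by
    cases d
    · exact .inr rfl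
    · exact .inl ⟨(r, true), rfl⟩
  obtain ⟨x, rfl⟩ | rfl | rfl | rfl | rfl := passage_cases x
  · cases d
    · exact .inl ⟨(x, false), rfl⟩
    by_cases hp : x = p
    · exact .inr (.inl ⟨true, by rw [hp]; rfl⟩)
    by_cases hq : x = q
    · exact .inr (.inr (.inl ⟨true, by rw [hq]; rfl⟩))
    · exact .inl ⟨(x, true), by rw [← lastPiece_of_ne hp hq]; rfl⟩
  · exact .inr (.inr (.inr (.inl ⟨d, rfl⟩)))
  · exact (last_cases p).imp_right fun h => .inl ⟨d, h⟩
  · exact .inr (.inr (.inr (.inr ⟨d, rfl⟩)))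
  · rw [← lastPiece_under hpq]
    exact (last_cases q).imp_right fun h => .inr (.inl ⟨d, h⟩)

theorem mk_firstDart_swap (hpq : p ≠ q) (z : D.Edge × Bool) :
    Orbits.mk (D.push p q s t).faceStep (firstDart (Equiv.swap (p, s) (q, t) z)) =
      Orbits.mk _ (lastDart z) := by
  obtain ⟨x, d⟩ := z
  by_cases hp : x = p
  · subst hp
    by_cases hd : d = s
    · rw [hd, Equiv.swap_apply_left, ← faceStep_firstDart_under hpq, Orbits.mk_apply]
    · rw [Equiv.swap_apply_of_ne_of_ne (by simp [hd]) (by simp [hpq]), Bool.eq_not_of_ne hd,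
        ← faceStep_midUnder hpq, Orbits.mk_apply, ← faceStep_firstDart_over_not hpq,
        Orbits.mk_apply]
  by_cases hq : x = q
  · subst hq
    by_cases hd : d = t
    · rw [hd, Equiv.swap_apply_right, ← faceStep_firstDart_over hpq, Orbits.mk_apply]
    · rw [Equiv.swap_apply_of_ne_of_ne (by simp [hp]) (by simp [hd]), Bool.eq_not_of_ne hd,
        ← faceStep_midOver hpq, Orbits.mk_apply, ← faceStep_firstDart_under_not hpq,
        Orbits.mk_apply]
  · rw [Equiv.swap_apply_of_ne_of_ne (by simp [hp]) (by simp [hq])]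
    simp [firstDart, lastDart, lastPiece_of_ne hp hq]

/-- The dart of the old diagram as a piece of which a dart of the new diagram is passed by the
boundary walk; `none` stands for the bigon. Pieces after the exchange between the darts `(p, s)` and
`(q, t)` are assigned to the dart with which the walk began. -/
def origin : (D.push p q s t).Edge × Bool → Option (D.Edge × Bool)
  | ((.inl c, b), true) => some ((c, b), true)
  | ((.inl c, b), false) => some (Equiv.swap (p, s) (q, t) ((c, b), false))
  | ((.inr i, true), d) =>
    if i = false then if d = s then some (q, !t) else none
    else some (if d then Equiv.swap (p, s) (q, t) (p, true) else (p, false))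
  | ((.inr i, false), d) =>
    if i = (s == t) then if d = t then some (p, !s) else none
    else some (if d then Equiv.swap (p, s) (q, t) (q, true) else (q, false))

theorem origin_lastDart (hpq : p ≠ q) (z : D.Edge × Bool) :
    origin (lastDart z : (D.push p q s t).Edge × Bool) =
      some (Equiv.swap (p, s) (q, t) z) := by
  obtain ⟨x, _ | _⟩ := z
  · rfl
  · simp only [lastDart, if_true]
    by_cases hp : x = p
    · rw [hp, lastPiece_over]
      rfl
    by_cases hq : x = q
    · rw [hq, lastPiece_under hpq]
      exact if_neg (by simp)
    rw [lastPiece_of_ne hp hq, Equiv.swap_apply_of_ne_of_ne (by simp [hp]) (by simp [hq])]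
    rfl

theorem origin_firstDart (hpq : p ≠ q) (z : D.Edge × Bool) :
    origin (firstDart z : (D.push p q s t).Edge × Bool) = some z := by
  obtain ⟨x, _ | _⟩ := z
  · simp only [firstDart]
    by_cases hp : x = p
    · rw [hp]
      exact congrArg (fun y => origin (y, false)) lastPiece_over
    by_cases hq : x = q
    · rw [hq]
      exact (congrArg (fun y => origin (y, false)) (lastPiece_under hpq)).trans (if_neg (by simp))
    refine (congrArg (fun y => origin (y, false)) (lastPiece_of_ne hp hq)).trans
      (congrArg some (Equiv.swap_apply_of_ne_of_ne (by simp [hp]) (by simp [hq])))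
  · rfl

theorem origin_midOver (d : Bool) : origin ((midOver, d) : (D.push p q s t).Edge × Bool) =
    if d = s then some (q, !t) else none := rfl

theorem origin_midUnder (d : Bool) : origin ((midUnder, d) : (D.push p q s t).Edge × Bool) =
    if d = t then some (p, !s) else none :=
  if_pos (c := (s == t) = (s == t)) rfl

theorem origin_faceStep (hpq : p ≠ q) {y : (D.push p q s t).Edge × Bool}
    (hlast : ∀ z, y ≠ lastDart z) (hbigon : y ≠ (midOver, !s)) :
    origin ((D.push p q s t).faceStep y) = origin y := by
  obtain ⟨z, rfl⟩ | ⟨d, rfl⟩ | ⟨d, rfl⟩ | ⟨d, rfl⟩ | ⟨d, rfl⟩ := dart_cases hpq y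
  · exact absurd rfl (hlast z)
  · obtain rfl | hd := eq_or_ne d s
    · rw [faceStep_firstDart_over hpq, origin_lastDart hpq, origin_firstDart hpq,
        Equiv.swap_apply_right]
    · rw [Bool.eq_not_of_ne hd, faceStep_firstDart_over_not hpq, origin_midUnder,
        origin_firstDart hpq, if_pos rfl]
  · obtain rfl | hd := eq_or_ne d t
    · rw [faceStep_firstDart_under hpq, origin_lastDart hpq, origin_firstDart hpq,
        Equiv.swap_apply_left]
    · rw [Bool.eq_not_of_ne hd, faceStep_firstDart_under_not hpq, origin_midOver,
        origin_firstDart hpq, if_pos rfl]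
  · obtain rfl | hd := eq_or_ne d s
    · rw [faceStep_midOver hpq, origin_lastDart hpq, origin_midOver, if_pos rfl,
        Equiv.swap_apply_of_ne_of_ne] <;> simp [hpq.symm]
    · exact absurd (by rw [Bool.eq_not_of_ne hd]) hbigon
  · obtain rfl | hd := eq_or_ne d t
    · rw [faceStep_midUnder hpq, origin_lastDart hpq, origin_midUnder, if_pos rfl,
        Equiv.swap_apply_of_ne_of_ne] <;> simp [hpq]
    · rw [Bool.eq_not_of_ne hd, faceStep_midUnder_not, origin_midOver, origin_midUnder]
      simp

theorem mk_origin (hpq : p ≠ q) (y : (D.push p q s t).Edge × Bool) :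
    Orbits.mk (D.push p q s t).faceStep ((origin y).elim (midUnder, !t) firstDart) =
      Orbits.mk _ y := by
  obtain ⟨z, rfl⟩ | ⟨d, rfl⟩ | ⟨d, rfl⟩ | ⟨d, rfl⟩ | ⟨d, rfl⟩ := dart_cases hpq y
  · rw [origin_lastDart hpq]
    exact mk_firstDart_swap hpq z
  · rw [origin_firstDart hpq]; rfl
  · rw [origin_firstDart hpq]; rfl
  · obtain rfl | hd := eq_or_ne d s
    · rw [origin_midOver, if_pos rfl, ← faceStep_firstDart_under_not hpq, Orbits.mk_apply]; rfl
    · rw [origin_midOver, if_neg hd, Bool.eq_not_of_ne hd, ← Orbits.mk_apply _ (midOver, _),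
        faceStep_midOver_not]; rfl
  · obtain rfl | hd := eq_or_ne d t
    · rw [origin_midUnder, if_pos rfl, ← faceStep_firstDart_over_not hpq, Orbits.mk_apply]; rfl
    · rw [origin_midUnder, if_neg hd, Bool.eq_not_of_ne hd]; rfl

theorem card_face (hpq : p ≠ q) (h : D.facePerm.SameCycle (p, s) (q, t)) :
    Nat.card (D.push p q s t).Face = Nat.card D.Face + 2 := by
  let f : Equiv.Perm (Option (D.Edge × Bool)) := D.facePerm.optionCongr
  let σ := Equiv.swap (some (p, s)) (some (q, t))
  have σ_some (z : D.Edge × Bool) : σ (some z) = some (Equiv.swap (p, s) (q, t) z) :=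
    ((Option.some_injective _).map_swap ..).symm
  have σ_none : σ none = none := Equiv.swap_apply_of_ne_of_ne nofun nofun
  have h_some : f.SameCycle (some (p, s)) (some (q, t)) :=
    sameCycle_map some (fun z => sameCycle_of_apply_eq rfl) h
  calc Nat.card (D.push p q s t).Face = Nat.card (Orbits (f * σ)) := by
        refine Orbits.card_eq_of_pieces (f := f) (g := (D.push p q s t).faceStep) (σ := σ)
          (Equiv.swap_apply_self _ _) (·.elim (midUnder, !t) firstDart)
          (·.elim (midOver, !s) lastDart) origin ?_ ?_ ?_ ?_ (mk_origin hpq)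
        · rintro (_ | z)
          · exact faceStep_midOver_not
          · exact faceStep_lastDart z
        · rintro (_ | z)
          · exact (origin_midUnder _).trans (by simp)
          · exact origin_firstDart hpq z
        · rintro (_ | z)
          · exact (origin_midOver _).trans (by simp [σ_none])
          · exact (origin_lastDart hpq z).trans (σ_some z).symm
        · refine fun y => or_iff_not_imp_left.2 fun hy => origin_faceStep hpq ?_ ?_
          · rintro z rfl
            exact hy ⟨some z, rfl⟩
          · rintro rfl
            exact hy ⟨none, rfl⟩
    _ = Nat.card (Orbits f) + 1 := Orbits.card_mul_swap f (by simp [hpq]) h_some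
    _ = Nat.card (Orbits D.facePerm) + 1 + 1 := by rw [Orbits.card_optionCongr]

theorem sameCycle_old (hpq : p ≠ q) {x y : D.Edge} (h : D.next.SameCycle x y) :
    (D.push p q s t).next.SameCycle (old x) (old y) := by
  refine sameCycle_map old (fun z => ?_) h
  by_cases hp : z = p
  · rw [hp]
    exact (sameCycle_of_apply_eq (next_old_over hpq)).trans <|
      (sameCycle_of_apply_eq next_midOver).trans <| sameCycle_of_apply_eq next_last_over
  by_cases hq : z = q
  · rw [hq]
    exact (sameCycle_of_apply_eq next_old_under).trans <|
      (sameCycle_of_apply_eq next_midUnder).trans <| sameCycle_of_apply_eq (next_last_under hpq)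
  · exact sameCycle_of_apply_eq (next_old hp hq)

theorem exists_sameCycle_old (hpq : p ≠ q) (y : (D.push p q s t).Edge) :
    ∃ x, (D.push p q s t).next.SameCycle (old x) y := by
  have lastPiece_sameCycle (r : D.Edge) :
      (D.push p q s t).next.SameCycle (old (D.next r)) (lastPiece r) :=
    (sameCycle_of_apply_eq (next_lastPiece r)).symm
  obtain ⟨x, rfl⟩ | rfl | rfl | rfl | rfl := passage_cases y
  · exact ⟨x, .refl _ _⟩
  · exact ⟨p, sameCycle_of_apply_eq (next_old_over hpq)⟩
  · exact ⟨_, lastPiece_sameCycle p⟩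
  · exact ⟨q, sameCycle_of_apply_eq next_old_under⟩
  · exact ⟨_, lastPiece_under hpq ▸ lastPiece_sameCycle q⟩

end push

end GaussCode

/-- The diagram that arises when `p` is pushed over `q` across a common face. -/
def KnotDiagram.push (D : KnotDiagram) {p q : D.Edge} (hpq : p ≠ q) {s t : Bool}
    (h : D.facePerm.SameCycle (p, s) (q, t)) : KnotDiagram where
  toGaussCode := D.toGaussCode.push p q s t
  one_component x y := by
    obtain ⟨x', hx⟩ := GaussCode.push.exists_sameCycle_old hpq x
    obtain ⟨y', hy⟩ := GaussCode.push.exists_sameCycle_old hpq y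
    exact hx.symm.trans ((GaussCode.push.sameCycle_old hpq (D.one_component x' y')).trans hy)
  planar := by
    rw [GaussCode.push.card_face hpq h]
    have := D.planar
    change Fintype.card (D.Crossing ⊕ Bool) + _ = Fintype.card ((D.Crossing ⊕ Bool) × Bool) + 2
    simp only [Fintype.card_sum, Fintype.card_prod, Fintype.card_bool] at this ⊢
    omega

/-! ### Colors after a push -/

namespace ColoredDiagram

open GaussCode.push

variable {X : Type*} [Quandle X]

section Push

variable (K : ColoredDiagram X)

/-- The color of an edge is the color of the arc that contains it. -/
def edgeColor (x : K.diagram.Edge) : X := K.color (K.diagram.arcOf x)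

theorem edgeColor_next {x : K.diagram.Edge} (h : (K.diagram.next x).2 = true) :
    K.edgeColor (K.diagram.next x) = K.edgeColor x :=
  congrArg K.color (Quot.sound ⟨rfl, h⟩).symm

/-- The colors of the edges after `p` has been pushed over `q`: only the middle piece of `q` gets a
new color, which depends on whether it lies to the left or to the right of `p`. -/
def pushColor (p q : K.diagram.Edge) (s t : Bool) : (K.diagram.toGaussCode.push p q s t).Edge → X
  | (.inl c, b) => K.edgeColor (c, b)
  | (.inr _, true) => K.edgeColor p
  | (.inr i, false) =>
    if i = (s == t) then
      if s then K.edgeColor p ◃⁻¹ K.edgeColor q else K.edgeColor p ◃ K.edgeColor q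
    else K.edgeColor q

variable {p q : K.diagram.Edge} {s t : Bool}

theorem pushColor_lastPiece (hpq : p ≠ q) (x : K.diagram.Edge) :
    K.pushColor p q s t (lastPiece x) = K.edgeColor x := by
  by_cases hp : x = p
  · rw [hp, lastPiece_over]; rfl
  by_cases hq : x = q
  · rw [hq, lastPiece_under hpq]
    exact if_neg (by simp)
  · rw [lastPiece_of_ne hp hq]; rfl

theorem pushColor_next (hpq : p ≠ q) {y : (K.diagram.toGaussCode.push p q s t).Edge}
    (h : ((K.diagram.toGaussCode.push p q s t).next y).2 = true) :
    K.pushColor p q s t ((K.diagram.toGaussCode.push p q s t).next y) =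
      K.pushColor p q s t y := by
  have next_last (x : K.diagram.Edge)
      (h : ((K.diagram.toGaussCode.push p q s t).next (lastPiece x)).2 = true) :
      K.pushColor p q s t ((K.diagram.toGaussCode.push p q s t).next (lastPiece x)) =
        K.pushColor p q s t (lastPiece x) := by
    rw [next_lastPiece] at h ⊢
    rw [pushColor_lastPiece K hpq]
    exact K.edgeColor_next h
  obtain ⟨x, rfl⟩ | rfl | rfl | rfl | rfl := passage_cases y
  · by_cases hp : x = p
    · rw [hp, next_old_over hpq]; rfl
    by_cases hq : x = q
    · rw [hq, next_old_under] at h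
      cases h
    rw [← lastPiece_of_ne hp hq] at h ⊢
    exact next_last x h
  · rw [next_midOver]; rfl
  · exact next_last p h
  · rw [next_midUnder] at h
    cases h
  · rw [← lastPiece_under hpq] at h ⊢
    exact next_last q h

theorem pushColor_symm_old (hpq : p ≠ q) (x : K.diagram.Edge) :
    K.pushColor p q s t ((K.diagram.toGaussCode.push p q s t).next.symm (old x)) =
      K.edgeColor (K.diagram.next.symm x) := by
  rw [← pushColor_lastPiece K hpq, lastPiece, Equiv.apply_symm_apply]

theorem pushColor_symm_new (i : Bool) :
    K.pushColor p q s t ((K.diagram.toGaussCode.push p q s t).next.symm (new i false)) =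
      if i = (s == t) then K.edgeColor q
      else if s then K.edgeColor p ◃⁻¹ K.edgeColor q else K.edgeColor p ◃ K.edgeColor q := by
  split_ifs with hi
  · rw [hi]
    exact congrArg (K.pushColor p q s t) ((Equiv.symm_apply_eq _).2 next_old_under.symm)
  all_goals
    rw [Bool.eq_not_of_ne hi, (Equiv.symm_apply_eq _).2 next_midUnder.symm]
    simp [midUnder, new, pushColor, *]

theorem pushColor_pos (hpq : p ≠ q) (c : (K.diagram.toGaussCode.push p q s t).Crossing)
    (hc : (K.diagram.toGaussCode.push p q s t).sign c = 1) :
    K.pushColor p q s t (c, false) = K.pushColor p q s t (c, true) ◃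
      K.pushColor p q s t ((K.diagram.toGaussCode.push p q s t).next.symm (c, false)) := by
  obtain c | i := c
  · exact (K.pos c hc).trans (congrArg _ (K.pushColor_symm_old hpq (c, false)).symm)
  · refine .trans ?_ (congrArg _ (K.pushColor_symm_new i).symm)
    cases i <;> cases s <;> cases t <;> simp [pushColor, GaussCode.push] at hc ⊢

theorem pushColor_neg (hpq : p ≠ q) (c : (K.diagram.toGaussCode.push p q s t).Crossing)
    (hc : (K.diagram.toGaussCode.push p q s t).sign c = -1) :
    K.pushColor p q s t ((K.diagram.toGaussCode.push p q s t).next.symm (c, false)) =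
      K.pushColor p q s t (c, true) ◃ K.pushColor p q s t (c, false) := by
  obtain c | i := c
  · exact (K.pushColor_symm_old hpq (c, false)).trans (K.neg c hc)
  · refine (K.pushColor_symm_new i).trans ?_
    cases i <;> cases s <;> cases t <;> simp [pushColor, GaussCode.push] at hc ⊢

/-- The colored diagram that arises when `p` is pushed over `q` across a common face. -/
def push (hpq : p ≠ q) (h : K.diagram.facePerm.SameCycle (p, s) (q, t)) : ColoredDiagram X where
  diagram := K.diagram.push hpq h
  color := Quot.lift (K.pushColor p q s t)
    (by rintro x _ ⟨rfl, h⟩; exact (K.pushColor_next hpq h).symm)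
  pos := K.pushColor_pos hpq
  neg := K.pushColor_neg hpq

theorem color_arcOf_lastPiece (hpq : p ≠ q) (h : K.diagram.facePerm.SameCycle (p, s) (q, t))
    (x : K.diagram.Edge) :
    (K.push hpq h).color ((K.push hpq h).diagram.arcOf (lastPiece x)) = K.edgeColor x :=
  K.pushColor_lastPiece hpq x

theorem color_arcOf_midOver (hpq : p ≠ q) (h : K.diagram.facePerm.SameCycle (p, s) (q, t)) :
    (K.push hpq h).color ((K.push hpq h).diagram.arcOf midOver) = K.edgeColor p :=
  rfl

end Push

end ColoredDiagram

namespace GaussCode.push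

variable {D : GaussCode} {p q : D.Edge} {s t : Bool}

theorem exists_iterate_next_old (hpq : p ≠ q) (x : D.Edge) : ∃ k : ℕ,
    (D.push p q s t).next^[k + 1] (old x) = old (D.next x) ∧
      ∀ j < k, ∃ i b, (D.push p q s t).next^[j + 1] (old x) = new i b := by
  have of_two_new {i i' b b' : Bool} (h1 : (D.push p q s t).next (old x) = new i b)
      (h2 : (D.push p q s t).next (new i b) = new i' b')
      (h3 : (D.push p q s t).next (new i' b') = old (D.next x)) : ∃ k : ℕ,
      (D.push p q s t).next^[k + 1] (old x) = old (D.next x) ∧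
        ∀ j < k, ∃ i b, (D.push p q s t).next^[j + 1] (old x) = new i b := by
    refine ⟨2, by simp only [Function.iterate_succ_apply, Function.iterate_zero_apply, h1, h2, h3],
      fun j hj => ?_⟩
    interval_cases j
    · exact ⟨i, b, h1⟩
    · exact ⟨i', b', by
        simp only [Function.iterate_succ_apply, Function.iterate_zero_apply, h1, h2]⟩
  by_cases hp : x = p
  · subst hp
    exact of_two_new (next_old_over hpq) next_midOver next_last_over
  by_cases hq : x = q
  · subst hq
    exact of_two_new next_old_under next_midUnder (next_last_under hpq)
  · exact ⟨0, next_old hp hq, nofun⟩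

end GaussCode.push

open GaussCode.push in
/-- Pushing an edge over another one as a Reidemeister II move. -/
def R2Creation.push (D : KnotDiagram) {p q : D.Edge} (hpq : p ≠ q) {s t : Bool}
    (h : D.facePerm.SameCycle (p, s) (q, t)) : R2Creation D (D.push hpq h) where
  c₁ := .inr false
  c₂ := .inr true
  sign_ne := by
    change (if false = t then (-1 : ℤˣ) else 1) ≠ if true = t then (-1 : ℤˣ) else 1
    cases t <;> decide
  over_consecutive := next_midOver
  under_consecutive := by
    have := next_midUnder (D := D.toGaussCode) (p := p) (q := q) (s := s) (t := t)
    rw [midUnder] at this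
    cases h : s == t <;> rw [h] at this
    · exact .inl this
    · exact .inr this
  incl := Sum.inl
  incl_injective := Sum.inl_injective
  range_incl := by
    change ∀ c : D.Crossing ⊕ Bool, c ∈ Set.range Sum.inl ↔ c ≠ .inr false ∧ c ≠ .inr true
    rintro (c | _ | _) <;> simp
  sign_incl _ := rfl
  next_incl x := by
    obtain ⟨k, hk, hj⟩ := exists_iterate_next_old (s := s) (t := t) hpq x
    refine ⟨k, hk, fun j h => ?_⟩
    obtain ⟨i, b, h⟩ := hj j h
    have : (new i b : (D.toGaussCode.push p q s t).Edge).1 = .inr false ∨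
        (new i b : (D.toGaussCode.push p q s t).Edge).1 = .inr true := by
      cases i
      · exact .inl rfl
      · exact .inr rfl
    exact h ▸ this

section Creation

variable {X : Type*} [Quandle X] {K K' : ColoredDiagram X}

theorem ColoredR2Creation.push (K : ColoredDiagram X) {p q : K.diagram.Edge} (hpq : p ≠ q)
    {s t : Bool} (h : K.diagram.facePerm.SameCycle (p, s) (q, t)) :
    ColoredR2Creation K (K.push hpq h) :=
  ⟨.push K.diagram hpq h, fun _ => rfl⟩

theorem ColoredR2Creation.isNontrivial (h : ColoredR2Creation K K') (hK : K.IsNontrivial) :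
    K'.IsNontrivial := by
  obtain ⟨m, hm⟩ := h
  obtain ⟨⟨x⟩, ⟨y⟩, hxy⟩ := hK
  exact ⟨_, _, ne_of_eq_of_ne (hm x) (hxy.trans_eq (hm y).symm)⟩

theorem isNontrivial_of_reflTransGen
    (h : Relation.ReflTransGen ColoredR2Creation K K') (hK : K.IsNontrivial) : K'.IsNontrivial := by
  induction h with
  | refl => exact hK
  | tail _ h ih => exact h.isNontrivial ih

end Creation

/-! ### Cutting two edges at a common face -/

namespace GaussCode

/-- The cyclic order of the four ends of the strands in `cut` below. -/
def cutBoundary (s : Bool) : Equiv.Perm (Bool × Bool) where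
  toFun a := (!a.1, (a.1 == a.2) == s)
  invFun a := (!a.1, (a.1 == a.2) == !s)
  left_inv := by revert s; decide
  right_inv := by revert s; decide

theorem sameCycle_cutBoundary (s : Bool) (a b : Bool × Bool) : (cutBoundary s).SameCycle a b := by
  have : ∀ s a b, ∃ n : Fin 4, (cutBoundary s)^[n] a = b := by decide
  obtain ⟨n, hn⟩ := this s a b
  exact ⟨n, by rw [zpow_natCast, coe_pow]; exact hn⟩

/-- The permutation `next` of the tangle `cut` below. Multiplication by `swap (inl x) (inr i)`
inserts the endpoint `inr i` after the passage `x`. -/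
def cutNext (D : GaussCode) (e f : D.Edge) : Equiv.Perm (D.Edge ⊕ Bool) :=
  D.next.sumCongr Equiv.boolNot * Equiv.swap (.inl e) (.inr false) *
    Equiv.swap (.inl f) (.inr true)

/-- The tangle that arises when the edges `e ≠ f` are cut, across a face that is on the left of the
darts `(e, s)` and `(f, !s)`. -/
def cut (D : GaussCode) (e f : D.Edge) (s : Bool) : TangleCode where
  Crossing := D.Crossing
  sign := D.sign
  next := D.cutNext e f
  boundaryNext := cutBoundary s

namespace cut

variable {D : GaussCode} {e f : D.Edge} {s : Bool}

/-- A passage of the knot diagram as a passage of the tangle. -/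
def passage (x : D.Edge) : (D.cut e f s).Edge := .inl x

/-- The initial, or terminal, endpoint of the strand `i`. -/
def endpoint (i : Bool) : (D.cut e f s).Edge := .inr i

/-- The last piece of an edge of the knot diagram. -/
def lastPiece (x : D.Edge) : (D.cut e f s).Edge := (D.cut e f s).next.symm (passage (D.next x))

theorem next_start (hef : e ≠ f) : (D.cut e f s).next (passage e) = endpoint true := by
  change D.cutNext e f (.inl e) = .inr true
  simp [cutNext, Equiv.swap_apply_def, hef]

theorem next_end : (D.cut e f s).next (passage f) = endpoint false := by
  change D.cutNext e f (.inl f) = .inr false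
  simp [cutNext, Equiv.swap_apply_def]

theorem next_passage {x : D.Edge} (he : x ≠ e) (hf : x ≠ f) :
    (D.cut e f s).next (passage x) = passage (D.next x) := by
  change D.cutNext e f (.inl x) = .inl (D.next x)
  simp [cutNext, Equiv.swap_apply_def, he, hf]

theorem edge_cases (y : (D.cut e f s).Edge) :
    (∃ x, y = passage x) ∨ y = endpoint false ∨ y = endpoint true := by
  obtain x | _ | _ := y
  · exact .inl ⟨x, rfl⟩
  · exact .inr (.inl rfl)
  · exact .inr (.inr rfl)

theorem next_endpoint_false : (D.cut e f s).next (endpoint false) = passage (D.next e) := by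
  change D.cutNext e f (.inr false) = .inl (D.next e)
  simp [cutNext, Equiv.swap_apply_def]

theorem next_endpoint_true (hef : e ≠ f) :
    (D.cut e f s).next (endpoint true) = passage (D.next f) := by
  change D.cutNext e f (.inr true) = .inl (D.next f)
  simp [cutNext, Equiv.swap_apply_def, hef.symm]

theorem next_lastPiece (x : D.Edge) :
    (D.cut e f s).next (lastPiece x) = passage (D.next x) :=
  (D.cut e f s).next.apply_symm_apply _

theorem lastPiece_start : (lastPiece e : (D.cut e f s).Edge) = endpoint false :=
  (Equiv.symm_apply_eq _).2 next_endpoint_false.symm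

theorem lastPiece_end (hef : e ≠ f) : (lastPiece f : (D.cut e f s).Edge) = endpoint true :=
  (Equiv.symm_apply_eq _).2 (next_endpoint_true hef).symm

theorem lastPiece_of_ne {x : D.Edge} (he : x ≠ e) (hf : x ≠ f) :
    (lastPiece x : (D.cut e f s).Edge) = passage x :=
  (Equiv.symm_apply_eq _).2 (next_passage he hf).symm

/-- The first piece of a dart of the knot diagram. -/
def firstDart (z : D.Edge × Bool) : (D.cut e f s).Edge × Bool :=
  (if z.2 then passage z.1 else lastPiece z.1, z.2)

/-- The last piece of a dart of the knot diagram. -/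
def lastDart (z : D.Edge × Bool) : (D.cut e f s).Edge × Bool :=
  (if z.2 then lastPiece z.1 else passage z.1, z.2)

theorem firstDart_eq_lastDart {z : D.Edge × Bool} (he : z.1 ≠ e) (hf : z.1 ≠ f) :
    (firstDart z : (D.cut e f s).Edge × Bool) = lastDart z := by
  simp [firstDart, lastDart, lastPiece_of_ne he hf]

theorem dart_cases (hef : e ≠ f) (y : (D.cut e f s).Edge × Bool) :
    (∃ z, y = firstDart z) ∨ ∃ z, y = lastDart z := by
  obtain ⟨x | i, _ | _⟩ := y
  · exact .inr ⟨(x, false), rfl⟩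
  · exact .inl ⟨(x, true), rfl⟩
  all_goals cases i
  · exact .inl ⟨(e, false), congrArg (·, false) lastPiece_start.symm⟩
  · exact .inl ⟨(f, false), congrArg (·, false) (lastPiece_end hef).symm⟩
  · exact .inr ⟨(e, true), congrArg (·, true) lastPiece_start.symm⟩
  · exact .inr ⟨(f, true), congrArg (·, true) (lastPiece_end hef).symm⟩

theorem faceStep_of_next {x : (D.cut e f s).Edge} {y : D.Edge}
    (h : (D.cut e f s).next x = passage y) : (D.cut e f s).faceStep (x, true) =
      if CrossedLeftward D.sign y then (passage (other y), true)
      else ((D.cut e f s).next.symm (passage (other y)), false) := by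
  rw [passage] at h
  simp only [TangleCode.faceStep, h]
  rfl

theorem faceStep_of_next_endpoint {x : (D.cut e f s).Edge} {i : Bool}
    (h : (D.cut e f s).next x = endpoint i) : (D.cut e f s).faceStep (x, true) =
      (D.cut e f s).enter (cutBoundary s (i, false)) := by
  rw [endpoint] at h
  simp only [TangleCode.faceStep, h]
  rfl

theorem faceStep_lastDart (z : D.Edge × Bool) :
    (D.cut e f s).faceStep (lastDart z) = firstDart (D.faceStep z) := by
  have h_symm (y : D.Edge) :
      (D.cut e f s).next.symm (passage y) = lastPiece (D.next.symm y) := by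
    rw [lastPiece, Equiv.apply_symm_apply]
  obtain ⟨x, _ | _⟩ := z
  · change (if CrossedLeftward D.sign x
      then ((D.cut e f s).next.symm (passage (other x)), false) else (passage (other x), true)) = _
    simp only [GaussCode.faceStep]
    split_ifs
    · exact congrArg (·, false) (h_symm _)
    · rfl
  · refine (faceStep_of_next (next_lastPiece x)).trans ?_
    simp only [GaussCode.faceStep]
    split_ifs
    · rfl
    · exact congrArg (·, false) (h_symm _)

theorem enter_eq_lastDart (hef : e ≠ f) (i b : Bool) :
    (D.cut e f s).enter (i, b) = lastDart (if i = b then f else e, b) := by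
  cases b <;> cases i
  · exact congrArg (·, false) ((Equiv.symm_apply_eq _).2 next_end.symm)
  · exact congrArg (·, false) ((Equiv.symm_apply_eq _).2 (next_start hef).symm)
  · exact congrArg (·, true) lastPiece_start.symm
  · exact congrArg (·, true) (lastPiece_end hef).symm

theorem faceStep_firstDart_start (hef : e ≠ f) (d : Bool) :
    (D.cut e f s).faceStep (firstDart (e, d)) = lastDart (if d = s then f else e, !s) := by
  have : (D.cut e f s).faceStep (firstDart (e, d)) =
      (D.cut e f s).enter (cutBoundary s (d, !d)) := by
    cases d
    · exact congrArg (fun x => (D.cut e f s).faceStep (x, false)) lastPiece_start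
    · exact faceStep_of_next_endpoint (next_start hef)
  rw [this, ← if_congr (Bool.not_inj_iff (x := d) (y := s)) rfl rfl, ← enter_eq_lastDart hef]
  cases d <;> cases s <;> rfl

theorem faceStep_firstDart_end (hef : e ≠ f) (d : Bool) :
    (D.cut e f s).faceStep (firstDart (f, d)) = lastDart (if d = s then f else e, s) := by
  have : (D.cut e f s).faceStep (firstDart (f, d)) =
      (D.cut e f s).enter (cutBoundary s (!d, !d)) := by
    cases d
    · exact congrArg (fun x => (D.cut e f s).faceStep (x, false)) (lastPiece_end hef)
    · exact faceStep_of_next_endpoint next_end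
  rw [this, ← enter_eq_lastDart hef]
  cases d <;> cases s <;> rfl

theorem faceStep_firstDart (hef : e ≠ f) (z : D.Edge × Bool) :
    (D.cut e f s).faceStep (firstDart z) = lastDart (Equiv.swap (e, s) (f, !s) z) ∨
      (firstDart z : (D.cut e f s).Edge × Bool) = lastDart (Equiv.swap (e, s) (f, !s) z) := by
  obtain ⟨x, d⟩ := z
  by_cases he : x = e
  · left
    rw [he, faceStep_firstDart_start hef]
    by_cases hd : d = s
    · simp [hd]
    · rw [if_neg hd, Equiv.swap_apply_of_ne_of_ne (by simp [hd]) (by simp [hef]),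
        Bool.eq_not_of_ne hd]
  by_cases hf : x = f
  · left
    rw [hf, faceStep_firstDart_end hef]
    by_cases hd : d = s
    · rw [if_pos hd, Equiv.swap_apply_of_ne_of_ne (by simp [hef.symm]) (by simp [hd]), hd]
    · simp [Bool.eq_not_of_ne hd]
  · right
    rw [Equiv.swap_apply_of_ne_of_ne (by simp [he]) (by simp [hf]),
      firstDart_eq_lastDart he hf]

/-- The dart of the knot diagram as a piece of which a dart of the tangle is passed by the boundary
walk. As for `push.origin`, pieces after the exchange are assigned to the dart with which the walk
began. -/
def origin : (D.cut e f s).Edge × Bool → D.Edge × Bool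
  | (.inl x, true) => (x, true)
  | (.inl x, false) => Equiv.swap (e, s) (f, !s) (x, false)
  | (.inr i, true) => Equiv.swap (e, s) (f, !s) (if i then f else e, true)
  | (.inr i, false) => (if i then f else e, false)

theorem origin_lastDart (hef : e ≠ f) (z : D.Edge × Bool) :
    origin (lastDart z : (D.cut e f s).Edge × Bool) = Equiv.swap (e, s) (f, !s) z := by
  obtain ⟨x, _ | _⟩ := z
  · rfl
  · by_cases he : x = e
    · rw [he]
      exact congrArg (fun y => origin (y, true)) lastPiece_start
    by_cases hf : x = f
    · rw [hf]
      exact congrArg (fun y => origin (y, true)) (lastPiece_end hef)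
    · rw [← firstDart_eq_lastDart he hf,
        Equiv.swap_apply_of_ne_of_ne (by simp [he]) (by simp [hf])]
      rfl

theorem origin_firstDart (hef : e ≠ f) (z : D.Edge × Bool) :
    origin (firstDart z : (D.cut e f s).Edge × Bool) = z := by
  obtain ⟨x, _ | _⟩ := z
  · by_cases he : x = e
    · rw [he]
      exact congrArg (fun y => origin (y, false)) lastPiece_start
    by_cases hf : x = f
    · rw [hf]
      exact congrArg (fun y => origin (y, false)) (lastPiece_end hef)
    · rw [firstDart_eq_lastDart he hf, origin_lastDart hef,
        Equiv.swap_apply_of_ne_of_ne (by simp [he]) (by simp [hf])]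
  · rfl

theorem card_face (hef : e ≠ f) (h : D.facePerm.SameCycle (e, s) (f, !s)) :
    Nat.card (D.cut e f s).Face = Nat.card D.Face + 1 := by
  have σσ := Equiv.swap_apply_self (e, s) (f, !s)
  refine .trans (Orbits.card_eq_of_pieces (f := D.facePerm) (g := (D.cut e f s).faceStep)
    σσ firstDart lastDart origin faceStep_lastDart (origin_firstDart hef) (origin_lastDart hef)
    (fun y => ?_) (fun y => ?_)) (Orbits.card_mul_swap D.facePerm (by simp [hef]) h)
  · obtain ⟨z, rfl⟩ | ⟨z, rfl⟩ := dart_cases hef y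
    · obtain hz | hz := faceStep_firstDart (s := s) hef z
      · right
        rw [hz, origin_lastDart hef, origin_firstDart hef, σσ]
      · exact .inl ⟨_, hz.symm⟩
    · exact .inl ⟨z, rfl⟩
  · obtain ⟨z, rfl⟩ | ⟨z, rfl⟩ := dart_cases hef y
    · rw [origin_firstDart hef]
    · rw [origin_lastDart hef]
      have hz := faceStep_firstDart (s := s) hef (Equiv.swap (e, s) (f, !s) z)
      rw [σσ] at hz
      obtain hz | hz := hz
      · rw [← hz, Orbits.mk_apply]
      · rw [hz]

theorem exists_sameCycle_endpoint (hef : e ≠ f) (h : ∀ x y, D.next.SameCycle x y)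
    (y : (D.cut e f s).Edge) : ∃ i, (D.cut e f s).next.SameCycle (endpoint i) y := by
  obtain ⟨x, rfl⟩ | rfl | rfl := edge_cases y
  · let P (x : D.Edge) : Prop := ∃ i, (D.cut e f s).next.SameCycle (endpoint i) (passage x)
    have P_next_start : P (D.next e) := ⟨false, sameCycle_of_apply_eq next_endpoint_false⟩
    refine (rel_of_sameCycle (Setoid.ker P) (fun x => propext ?_) (h (D.next e) x)).mp P_next_start
    by_cases he : x = e
    · rw [he]
      exact iff_of_true ⟨true, (sameCycle_of_apply_eq (next_start hef)).symm⟩ P_next_start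
    by_cases hf : x = f
    · rw [hf]
      exact iff_of_true ⟨false, (sameCycle_of_apply_eq next_end).symm⟩
        ⟨true, sameCycle_of_apply_eq (next_endpoint_true hef)⟩
    · simp only [P, ← next_passage he hf, sameCycle_apply_right]
  · exact ⟨false, .refl _ _⟩
  · exact ⟨true, .refl _ _⟩

/-- The edges of the tangle that belong to the strand `false`, where `U` consists of the passages
that are on it. -/
def strand (U : Finset D.Edge) : Set (D.cut e f s).Edge := Sum.elim (· ∈ U) (· = false)

variable {U : Finset D.Edge}

theorem next_mem_strand (hef : e ≠ f) (hU : IsSegment D.next e f U) (y : (D.cut e f s).Edge) :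
    (D.cut e f s).next y ∈ strand U ↔ y ∈ strand U := by
  have passage_mem (x : D.Edge) : (passage x : (D.cut e f s).Edge) ∈ strand U ↔ x ∈ U := .rfl
  obtain ⟨x, rfl⟩ | rfl | rfl := edge_cases y
  · by_cases he : x = e
    · rw [he, next_start hef]
      exact iff_of_false nofun hU.start_notMem
    by_cases hf : x = f
    · rw [hf, next_end]
      exact iff_of_true rfl hU.end_mem
    · rw [next_passage he hf, passage_mem, passage_mem, ← hU.apply_mem_iff x,
        Equiv.swap_apply_of_ne_of_ne he hf]
  · rw [next_endpoint_false, passage_mem]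
    exact iff_of_true (by simpa using (hU.apply_mem_iff f).2 hU.end_mem) rfl
  · rw [next_endpoint_true hef, passage_mem]
    exact iff_of_false (by simpa using (hU.apply_mem_iff e).not.2 hU.start_notMem) nofun

theorem mem_strand_iff_of_sameCycle (hef : e ≠ f) (hU : IsSegment D.next e f U)
    {y z : (D.cut e f s).Edge} (h : (D.cut e f s).next.SameCycle y z) :
    y ∈ strand U ↔ z ∈ strand U :=
  iff_of_eq <| rel_of_sameCycle (Setoid.ker (· ∈ strand U))
    (fun y => propext (next_mem_strand hef hU y).symm) h

theorem sameCycle_passage_iff (hef : e ≠ f) (hU : IsSegment D.next e f U)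
    (h : ∀ x y, D.next.SameCycle x y) (x y : D.Edge) :
    (D.cut e f s).next.SameCycle (passage x) (passage y) ↔ (x ∈ U ↔ y ∈ U) := by
  refine ⟨mem_strand_iff_of_sameCycle hef hU, fun hxy => ?_⟩
  obtain ⟨i, hi⟩ := exists_sameCycle_endpoint (s := s) hef h (passage x)
  obtain ⟨j, hj⟩ := exists_sameCycle_endpoint (s := s) hef h (passage y)
  have hx : i = false ↔ x ∈ U := mem_strand_iff_of_sameCycle hef hU hi
  have hy : j = false ↔ y ∈ U := mem_strand_iff_of_sameCycle hef hU hj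
  have hij : i = j := Bool.eq_iff_iff.2 (by simpa using (hx.trans (hxy.trans hy.symm)).not)
  exact hi.symm.trans (hij ▸ hj)

theorem not_sameCycle_endpoint (hef : e ≠ f) (h : D.next.SameCycle e f) :
    ¬ (D.cut e f s).next.SameCycle (endpoint false) (endpoint true) := by
  obtain ⟨U, hU⟩ := exists_isSegment hef h
  intro h_strand
  have : true = false := (mem_strand_iff_of_sameCycle hef hU h_strand).1 rfl
  cases this

end cut

end GaussCode

namespace KnotDiagram

open GaussCode.cut

variable (D : KnotDiagram) {e f : D.Edge} {s : Bool}

/-- The tangle diagram that arises when `e` and `f` are cut at a common face. -/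
def cut (hef : e ≠ f) (h : D.facePerm.SameCycle (e, s) (f, !s)) : TwoTangleDiagram where
  toTangleCode := D.toGaussCode.cut e f s
  two_strands := not_sameCycle_endpoint hef (D.one_component e f)
  no_closed_component := exists_sameCycle_endpoint hef D.one_component
  boundary_cyclic := GaussCode.sameCycle_cutBoundary s
  planar := by
    rw [card_face hef h]
    have := D.planar
    change Fintype.card D.Crossing + 1 + _ = Fintype.card ((D.Crossing × Bool) ⊕ Bool) + 2
    simp only [Fintype.card_sum, Fintype.card_bool] at this ⊢
    omega

/-- The tangle diagram `D.cut hef h` is a cut of `D`. -/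
def isCut_cut (hef : e ≠ f) (h : D.facePerm.SameCycle (e, s) (f, !s)) :
    IsCut D e f (D.cut hef h) where
  equiv := Equiv.refl _
  sign_equiv _ := rfl
  start_false := next_endpoint_false
  end_false := next_end
  start_true := next_endpoint_true hef
  end_true := next_start hef
  next_equiv _ he hf := next_passage he hf
  adjacent_e := by
    cases s
    · exact .inl rfl
    · exact .inr rfl
  adjacent_f := by
    cases s
    · exact .inr rfl
    · exact .inl rfl

end KnotDiagram

/-- The sum of the signs of the crossings that have one passage in `U` and the other one outside. -/
def GaussCode.crossingSum (D : GaussCode) (U : Finset D.Edge) : ℤ :=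
  ∑ x ∈ U with other x ∉ U, (D.sign x.1 : ℤ)

open GaussCode.cut in
theorem KnotDiagram.linkingNumber_cut (D : KnotDiagram) {e f : D.Edge} {s : Bool} (hef : e ≠ f)
    (h : D.facePerm.SameCycle (e, s) (f, !s)) {U : Finset D.Edge} (hU : IsSegment D.next e f U) :
    (D.cut hef h).linkingNumber = D.crossingSum U / 2 := by
  have sum_eq : D.crossingSum U =
      ∑ c, ∑ b, if (c, b) ∈ U then if other (c, b) ∉ U then (D.sign c : ℤ) else 0 else 0 := by
    rw [← Fintype.sum_prod_type', Finset.sum_ite_mem, Finset.univ_inter, ← Finset.sum_filter]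
    rfl
  rw [TwoTangleDiagram.linkingNumber, sum_eq, Int.cast_sum]
  congr 1
  refine Fintype.sum_congr _ _ fun (c : D.Crossing) => ?_
  refine (if_congr (sameCycle_passage_iff hef hU D.one_component _ _) rfl rfl).trans ?_
  change (if ((c, true) ∈ U ↔ (c, false) ∈ U) then (0 : ℚ) else (D.sign c : ℤ)) = _
  by_cases h_over : (c, true) ∈ U <;> by_cases h_under : (c, false) ∈ U <;>
    simp [h_over, h_under, other]

/-! ### A segment whose linking sum does not vanish -/

theorem GaussCode.eq_of_arcOf_eq {D : GaussCode} {x y : D.Edge} (h : D.arcOf y = D.arcOf x)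
    (h_start : x.2 = false) (h_end : (D.next x).2 = false) : y = x := by
  let isX : D.Arc → Prop := Quot.lift (· = x) <| by
    rintro u _ ⟨rfl, hu⟩
    refine propext (iff_of_false ?_ ?_)
    · rintro rfl
      exact Bool.false_ne_true (h_end.symm.trans hu)
    · intro hx
      exact Bool.false_ne_true (h_start.symm.trans (hx ▸ hu))
  exact (congrArg isX h).mpr rfl

namespace GaussCode.push

variable {D : GaussCode} {p q : D.Edge} {s t : Bool}

theorem new_ne_old (i b : Bool) (x : D.Edge) : (new i b : (D.push p q s t).Edge) ≠ old x :=
  fun h => Sum.inr_ne_inl (congrArg Prod.fst h)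

theorem new_inj {i b j c : Bool} :
    (new i b : (D.push p q s t).Edge) = new j c ↔ i = j ∧ b = c :=
  Prod.mk_inj.trans (and_congr_left' Sum.inr_injective.eq_iff)

theorem midOver_ne_old (x : D.Edge) : (midOver : (D.push p q s t).Edge) ≠ old x :=
  new_ne_old false true x

theorem lastPiece_under_ne_old (hpq : p ≠ q) :
    (lastPiece q : (D.push p q s t).Edge) ≠ old q := by
  rw [lastPiece_under hpq]
  exact new_ne_old _ _ q

theorem sameCycle_lastPiece_old (hpq : p ≠ q) :
    (D.push p q s t).facePerm.SameCycle (lastPiece q, !t) (old q, !t) := by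
  have h : (D.push p q s t).facePerm.SameCycle (firstDart (q, !t)) (lastDart (q, !t)) :=
    (sameCycle_of_apply_eq (faceStep_firstDart_under_not hpq)).trans
      (sameCycle_of_apply_eq (faceStep_midOver hpq))
  cases t
  · exact h.symm
  · exact h

theorem sameCycle_lastPiece_midOver (hpq : p ≠ q) :
    (D.push p q s s).facePerm.SameCycle (lastPiece q, !s) (midOver, !!s) := by
  cases s
  · exact (sameCycle_of_apply_eq (faceStep_midOver hpq)).symm
  · exact sameCycle_of_apply_eq (faceStep_firstDart_under_not (s := true) (t := true) hpq)

/-- The segment that starts after the outer piece `old q` of `q`, and ends with the other outer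
piece. -/
def underSegment : Finset (D.push p q s t).Edge := {midUnder, lastPiece q}

theorem isSegment_underSegment (hpq : p ≠ q) :
    IsSegment (D.push p q s t).next (old q) (lastPiece q) underSegment := by
  have h_last : (D.push p q s t).next midUnder = lastPiece q :=
    next_midUnder.trans (lastPiece_under hpq).symm
  have := isSegment_pair (f := (D.push p q s t).next) (a := old q)
  rw [next_old_under, h_last] at this
  exact this (new_ne_old _ _ q) (lastPiece_under_ne_old hpq)

theorem crossingSum_underSegment (hpq : p ≠ q) :
    (D.push p q s t).crossingSum underSegment = 0 := by
  have other_notMem (i : Bool) :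
      other (new i false) ∉ (underSegment : Finset (D.push p q s t).Edge) := by
    change new i true ∉ ({midUnder, lastPiece q} : Finset (D.push p q s t).Edge)
    simp [midUnder, lastPiece_under hpq, new_inj]
  rw [crossingSum, Finset.filter_true_of_mem, underSegment, lastPiece_under hpq, Finset.sum_pair]
  · cases s <;> cases t <;> simp [push, midUnder, new]
  · simp [midUnder, new_inj]
  · intro x hx
    rw [underSegment, lastPiece_under hpq, Finset.mem_insert, Finset.mem_singleton] at hx
    obtain rfl | rfl := hx
    exacts [other_notMem _, other_notMem _]

/-- If `U` is the segment from `q` to `p`, then this is the segment from the last piece of `q` to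
the middle piece of `p`. -/
def outerSegment (U : Finset D.Edge) : Finset (D.push p q s t).Edge := insert midOver (U.image old)

variable {U : Finset D.Edge}

theorem old_mem_outerSegment {x : D.Edge} :
    old x ∈ (outerSegment U : Finset (D.push p q s t).Edge) ↔ x ∈ U := by
  rw [outerSegment, Finset.mem_insert, or_iff_right (midOver_ne_old x).symm,
    old_injective.mem_finset_image]

theorem new_mem_outerSegment {i b : Bool} :
    new i b ∈ (outerSegment U : Finset (D.push p q s t).Edge) ↔ i = false ∧ b = true := by
  rw [outerSegment, Finset.mem_insert, midOver, new_inj, or_iff_left]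
  simp [(new_ne_old i b _).symm]

theorem isSegment_outerSegment (hpq : p ≠ q) (hU : IsSegment D.next q p U) :
    IsSegment (D.push p q s t).next (lastPiece q) midOver (outerSegment U) := by
  have h_start : (lastPiece q : (D.push p q s t).Edge) ∉ outerSegment U := by
    simp [lastPiece_under hpq, new_mem_outerSegment]
  have h_ne (x : D.Edge) : (old x : (D.push p q s t).Edge) ≠ lastPiece q := by
    rw [lastPiece_under hpq]
    exact (new_ne_old _ _ x).symm
  refine ⟨Finset.mem_insert_self _ _, h_start, fun y => ?_⟩
  obtain ⟨x, rfl⟩ | rfl | rfl | rfl | rfl := passage_cases y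
  · rw [Equiv.swap_apply_of_ne_of_ne (h_ne x) (midOver_ne_old x).symm, old_mem_outerSegment]
    by_cases hp : x = p
    · rw [hp, next_old_over hpq]
      exact iff_of_true (Finset.mem_insert_self _ _) hU.end_mem
    by_cases hq : x = q
    · rw [hq, next_old_under, midUnder, new_mem_outerSegment]
      simp [hU.start_notMem]
    · rw [next_old hp hq, old_mem_outerSegment, ← hU.apply_mem_iff x,
        Equiv.swap_apply_of_ne_of_ne hq hp]
  · rw [Equiv.swap_apply_right, next_lastPiece, old_mem_outerSegment]
    refine iff_of_true ?_ (Finset.mem_insert_self _ _)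
    simpa using (hU.apply_mem_iff p).2 hU.end_mem
  · rw [Equiv.swap_apply_of_ne_of_ne, next_lastPiece, old_mem_outerSegment, lastPiece_over,
      new_mem_outerSegment]
    · simpa using (hU.apply_mem_iff q).not.2 hU.start_notMem
    · simp [lastPiece_over, lastPiece_under hpq, new_inj]
    · simp [lastPiece_over, midOver, new_inj]
  · rw [Equiv.swap_apply_of_ne_of_ne, next_midUnder, midUnder, new_mem_outerSegment,
      new_mem_outerSegment]
    · simp
    · simp [midUnder, lastPiece_under hpq, new_inj]
    · simp [midUnder, midOver, new_inj]
  · rw [← lastPiece_under hpq, Equiv.swap_apply_left, next_midOver, new_mem_outerSegment]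
    simp [h_start]

theorem crossingSum_outerSegment : (D.push p q s t).crossingSum (outerSegment U) =
    (D.push p q s t).sign (.inr false) + D.crossingSum U := by
  have h_other (x : D.Edge) : other (old x : (D.push p q s t).Edge) = old (other x) := rfl
  have h_mid : other (midOver : (D.push p q s t).Edge) = new false false := rfl
  rw [crossingSum, Finset.sum_filter, outerSegment, Finset.sum_insert, ← outerSegment,
    Finset.sum_image old_injective.injOn, h_mid, if_pos (by simp [new_mem_outerSegment]),
    crossingSum, Finset.sum_filter]
  · simp only [h_other, old_mem_outerSegment]
    rfl
  · simp [(midOver_ne_old _).symm]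

theorem arcOf_lastPiece_ne_arcOf_midOver (hpq : p ≠ q) (h : (D.next q).2 = false) :
    (D.push p q s s).arcOf (lastPiece q) ≠ (D.push p q s s).arcOf midOver := by
  intro h_arc
  have h_start : (lastPiece q : (D.push p q s s).Edge).2 = false :=
    congrArg Prod.snd (lastPiece_under hpq)
  have h_end : ((D.push p q s s).next (lastPiece q)).2 = false := by rwa [next_lastPiece]
  have := eq_of_arcOf_eq h_arc.symm h_start h_end
  simp [lastPiece_under hpq, midOver, new_inj] at this

end GaussCode.push

open GaussCode.push in
theorem KnotDiagram.exists_isCut_push (D : KnotDiagram) {p q : D.Edge} {s : Bool} (hpq : p ≠ q)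
    (h : D.facePerm.SameCycle (p, s) (q, s)) {U : Finset D.Edge} (hU : IsSegment D.next q p U)
    (h_zero : D.crossingSum U = 0) :
    ∃ T : TwoTangleDiagram, Nonempty (IsCut (D.push hpq h) (lastPiece q) midOver T) ∧
      T.linkingNumber ≠ 0 := by
  have hef : (lastPiece q : (D.toGaussCode.push p q s s).Edge) ≠ midOver := by
    simp [lastPiece_under hpq, midOver, new_inj]
  refine ⟨_, ⟨(D.push hpq h).isCut_cut hef (sameCycle_lastPiece_midOver hpq)⟩, ?_⟩
  refine ne_of_eq_of_ne
    (linkingNumber_cut (D.push hpq h) hef _ (isSegment_outerSegment hpq hU)) ?_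
  refine div_ne_zero (Int.cast_ne_zero.2 ?_) two_ne_zero
  refine ne_of_eq_of_ne crossingSum_outerSegment ?_
  rw [h_zero, add_zero]
  exact Units.ne_zero _

end KnotTangle

open KnotTangle KnotTangle.GaussCode.push in
theorem corollary3p2_general {X : Type*} [Quandle X] (K : ColoredDiagram X) (a : K.diagram.Arc) :
    ∃ K' : ColoredDiagram X, Relation.ReflTransGen ColoredR2Creation K K' ∧
      ∃ a' b' : K'.diagram.Arc, a' ≠ b' ∧ K'.color a' = K.color a ∧ K'.color b' = K.color a ∧
        ∃ e f : K'.diagram.Edge, K'.diagram.arcOf e = a' ∧ K'.diagram.arcOf f = b' ∧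
          ∃ T : TwoTangleDiagram, Nonempty (IsCut K'.diagram e f T) ∧ T.linkingNumber ≠ 0 := by
  obtain ⟨x, rfl⟩ : ∃ x, K.diagram.arcOf x = a := Quot.exists_rep a
  obtain ⟨t, ht⟩ := K.diagram.exists_faceStep_ne x
  obtain ⟨⟨g, s⟩, h_step⟩ : ∃ z, K.diagram.faceStep (x, t) = z := ⟨_, rfl⟩
  rw [h_step] at ht
  have hgx : g ≠ x := ht
  let K₁ := K.push hgx (sameCycle_of_apply_eq h_step).symm
  let p : K₁.diagram.Edge := lastPiece x
  let q : K₁.diagram.Edge := old x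
  have hpq : p ≠ q := lastPiece_under_ne_old hgx
  have h_face : K₁.diagram.facePerm.SameCycle (p, !t) (q, !t) := sameCycle_lastPiece_old hgx
  have h_under : (K₁.diagram.next q).2 = false := congrArg Prod.snd next_old_under
  have h_color : K₁.edgeColor p = K.edgeColor x := K.color_arcOf_lastPiece hgx _ x
  obtain ⟨T, hT, h_linking⟩ := K₁.diagram.exists_isCut_push hpq h_face
    (isSegment_underSegment hgx) (crossingSum_underSegment hgx)
  exact ⟨K₁.push hpq h_face, .tail (.single (.push K hgx _)) (.push K₁ hpq h_face), _, _,
    arcOf_lastPiece_ne_arcOf_midOver hpq h_under,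
    K₁.color_arcOf_lastPiece hpq h_face q, (K₁.color_arcOf_midOver hpq h_face).trans h_color,
    _, _, rfl, rfl, T, hT, h_linking⟩

theorem corollary3p2 {X : Type*} [Quandle X] (K : KnotTangle.ColoredDiagram X)
    (hK : K.IsNontrivial) (a b : K.diagram.Arc) (hab : a ≠ b) (hcol : K.color a = K.color b) :
    ∃ K' : KnotTangle.ColoredDiagram X,
      Relation.ReflTransGen KnotTangle.ColoredR2Move K K' ∧ K'.IsNontrivial ∧
      ∃ a' b' : K'.diagram.Arc, a' ≠ b' ∧
        K'.color a' = K.color a ∧ K'.color b' = K.color a ∧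
        ∃ e f : K'.diagram.Edge, K'.diagram.arcOf e = a' ∧ K'.diagram.arcOf f = b' ∧
          ∃ T : KnotTangle.TwoTangleDiagram,
            Nonempty (KnotTangle.IsCut K'.diagram e f T) ∧ T.linkingNumber ≠ 0 := by
  obtain ⟨K', h, hT⟩ := corollary3p2_general K a
  exact ⟨K', Relation.ReflTransGen.mono (fun _ _ => .inl) _ _ h,
    KnotTangle.isNontrivial_of_reflTransGen h hK, hT⟩
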